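/- A polyhedral graph is a finite planar $3$-connected graph. For a positive integer $k$, a set $S$ of vertices of a graph $G$ is called $k$-independent if any two distinct vertices of $S$ are at distance greater than $k$ in $G$. Let $p(k,a)$ denote the least order (number of vertices) of a polyhedral graph that contains a $k$-independent set of size $a$. **Theorem.** Let $a \ge 2$ be an integer and let $k$ be an even positive integer. Then $p(k,a)$ exists (some polyhedral graph contains a $k$-independent set of size $a$) and $$p(k,a) = a + 3a\cdot\frac{k}{2} = \left(\frac{3}{2}k+1\right)a .$$ -/

import Mathlib

/-- `A` is a (Jordan) arc in the plane with ends `p` and `q`: the image of an injective path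
from `p` to `q`. -/
def IsPlaneArc (p q : ℝ × ℝ) (A : Set (ℝ × ℝ)) : Prop :=
  ∃ γ : Path p q, Function.Injective γ ∧ Set.range γ = A

/-- A graph is planar if it can be drawn in the plane without crossings: vertices are drawn as
distinct points, every edge as an arc between its two ends that passes through no other vertex,
and two distinct edges meet only in (the point of) a common end. -/
def SimpleGraph.IsPlanar {V : Type*} (G : SimpleGraph V) : Prop :=
  ∃ (pt : V → ℝ × ℝ) (arc : Sym2 V → Set (ℝ × ℝ)),
    Function.Injective pt ∧
    (∀ u v, G.Adj u v → IsPlaneArc (pt u) (pt v) (arc s(u, v))) ∧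
    (∀ u v w, G.Adj u v → pt w ∈ arc s(u, v) → w = u ∨ w = v) ∧
    (∀ e ∈ G.edgeSet, ∀ f ∈ G.edgeSet, e ≠ f →
      ∀ x ∈ arc e ∩ arc f, ∃ w : V, w ∈ e ∧ w ∈ f ∧ pt w = x)

/-- A finite graph is `t`-connected if it has more than `t` vertices and remains connected
whenever fewer than `t` vertices are deleted. -/
def SimpleGraph.IsVertexConnected {V : Type*} [Fintype V] (G : SimpleGraph V) (t : ℕ) : Prop :=
  t < Fintype.card V ∧
    ∀ X : Finset V, X.card < t → (G.induce {v : V | v ∉ X}).Connected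

/-- A polyhedral graph is a finite `3`-connected planar graph. -/
def SimpleGraph.IsPolyhedral {V : Type*} [Fintype V] (G : SimpleGraph V) : Prop :=
  G.IsVertexConnected 3 ∧ G.IsPlanar

/-- A set of vertices is `k`-independent if any two of its (distinct) members are at distance
greater than `k`; the distance is `⊤` between different components. -/
def SimpleGraph.IsKIndep {V : Type*} (G : SimpleGraph V) (k : ℕ) (S : Finset V) : Prop :=
  ∀ u ∈ S, ∀ v ∈ S, u ≠ v → (k : ℕ∞) < G.edist u v

/-- The orders of the polyhedral graphs that contain a `k`-independent set of size `a`. -/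
def polyhedralOrders (k a : ℕ) : Set ℕ :=
  {n | ∃ (V : Type) (_ : Fintype V) (G : SimpleGraph V),
    Fintype.card V = n ∧ G.IsPolyhedral ∧ ∃ S : Finset V, S.card = a ∧ G.IsKIndep k S}

namespace SimpleGraph

variable {V : Type*} {G : SimpleGraph V}

/-! ### Lower bound: spheres are cuts -/

/-! Write `k = 2m`. Lower bound: balls of radius `m` about the members of a `k`-independent set are
disjoint. A sphere of radius `1 ≤ i ≤ m` about one member separates it from any other, so
3-connectedness puts at least three vertices on it, and each ball has at least `3m + 1` vertices
(`le_card_ball`, `card_mul_le_card`). Sharpness: `TowerGraph.graph` is a union of `a` such minimal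
balls. Each tower is a three-column grid of height `m` closed by a tip, and towers meet only along
their bases. Between two tips one descends `m` steps, changes tower and climbs `m` steps, which
makes at least `2m + 1`. Planarity comes from a straight-line drawing on integer levels. For
3-connectedness, after two deletions every surviving vertex still reaches its base, and the
surviving base vertices remain connected to each other. -/

theorem IsVertexConnected.three_le_card_sphere [Fintype V] [DecidableEq V]
    (hG : G.IsVertexConnected 3) {s s' : V} {i : ℕ} (hi : 0 < i) (hs : (i : ℕ∞) < G.edist s s')
    (A : Finset V) (hA : ∀ v, v ∈ A ↔ G.edist s v = i) : 3 ≤ A.card := by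
  by_contra! hlt
  have hconn := (hG.2 A hlt).preconnected
  have h0 : s ∉ A := by
    rw [hA, edist_self]
    exact_mod_cast hi.ne
  have h1 : s' ∉ A := by
    rw [hA]
    exact hs.ne'
  obtain ⟨w⟩ := hconn ⟨s, h0⟩ ⟨s', h1⟩
  -- Each step changes the distance from `s` by at most one, so a walk that avoids the sphere never
  -- leaves its interior.
  have key : ∀ (x y : {v : V | v ∉ A}) (_ : (G.induce {v : V | v ∉ A}).Walk x y),
      G.edist s x < i → G.edist s y < i := by
    intro x y w
    induction w with
    | nil => exact id
    | @cons u v z huv _ ih =>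
      intro hu
      refine ih (lt_of_le_of_ne ?_ fun h => v.2 ((hA _).2 h))
      have huv' : G.edist (u : V) v = 1 := edist_eq_one_iff_adj.2 huv
      calc G.edist s v ≤ G.edist s u + G.edist (u : V) v := SimpleGraph.edist_triangle
        _ = G.edist s u + 1 := by rw [huv']
        _ ≤ i := Order.add_one_le_of_lt hu
  have hlt' := key _ _ w (by rw [edist_self]; exact_mod_cast hi)
  exact absurd hs hlt'.le.not_gt

theorem IsVertexConnected.le_card_ball [Fintype V] [DecidableEq V]
    (hG : G.IsVertexConnected 3) {s s' : V} (m : ℕ) (hs : (m : ℕ∞) < G.edist s s')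
    (B : Finset V) (hB : ∀ v, v ∈ B ↔ G.edist s v ≤ m) : 3 * m + 1 ≤ B.card := by
  classical
  induction m generalizing B with
  | zero =>
    have : s ∈ B := by rw [hB, edist_self]; simp
    have := Finset.card_pos.2 ⟨s, this⟩
    omega
  | succ m ih =>
    have hm : (m : ℕ∞) < ((m + 1 : ℕ) : ℕ∞) := by exact_mod_cast m.lt_succ_self
    have h1 := ih (hm.trans hs) {v | G.edist s v ≤ m} (by simp)
    have h2 := hG.three_le_card_sphere m.succ_pos hs {v | G.edist s v = ((m + 1 : ℕ) : ℕ∞)}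
      (by simp)
    have hd : Disjoint ({v | G.edist s v ≤ m} : Finset V)
        ({v | G.edist s v = ((m + 1 : ℕ) : ℕ∞)} : Finset V) := by
      rw [Finset.disjoint_left]
      intro v hv hv'
      simp only [Finset.mem_filter, Finset.mem_univ, true_and] at hv hv'
      rw [hv'] at hv
      exact absurd hm hv.not_gt
    have hsub : ({v | G.edist s v ≤ m} : Finset V) ∪
        ({v | G.edist s v = ((m + 1 : ℕ) : ℕ∞)} : Finset V) ⊆ B := by
      intro v hv
      simp only [Finset.mem_union, Finset.mem_filter, Finset.mem_univ, true_and] at hv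
      rw [hB]
      rcases hv with hv | hv
      · exact hv.trans hm.le
      · exact hv.le
    have h3 := Finset.card_le_card hsub
    rw [Finset.card_union_of_disjoint hd] at h3
    omega

theorem IsVertexConnected.card_mul_le_card [Fintype V] (hG : G.IsVertexConnected 3) {m : ℕ}
    {S : Finset V} (hS : G.IsKIndep (m + m) S) (hcard : 2 ≤ S.card) :
    S.card * (3 * m + 1) ≤ Fintype.card V := by
  classical
  let B : V → Finset V := fun s => {v | G.edist s v ≤ m}
  have hdisj : (S : Set V).PairwiseDisjoint B := by
    intro s hs t ht hst
    rw [Function.onFun, Finset.disjoint_left]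
    intro v hv hv'
    simp only [B, Finset.mem_filter, Finset.mem_univ, true_and] at hv hv'
    refine absurd (hS s hs t ht hst) (not_lt.2 ?_)
    rw [edist_comm] at hv'
    push_cast
    exact SimpleGraph.edist_triangle.trans (add_le_add hv hv')
  have hB : ∀ s ∈ S, 3 * m + 1 ≤ (B s).card := by
    intro s hs
    -- A second member of `S` is what the spheres about `s` cut off.
    obtain ⟨t, ht, hts⟩ := Finset.exists_mem_ne (s := S) (by omega) s
    refine hG.le_card_ball (s' := t) m (lt_of_le_of_lt ?_ (hS s hs t ht hts.symm)) _ (by simp [B])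
    exact_mod_cast Nat.le_add_left m m
  calc S.card * (3 * m + 1) ≤ ∑ s ∈ S, (B s).card := by
        simpa using Finset.card_nsmul_le_sum S _ _ hB
    _ = (S.biUnion B).card := (Finset.card_biUnion hdisj).symm
    _ ≤ Fintype.card V := Finset.card_le_univ _

/-! ### Levelled drawings -/

theorem isPlaneArc_segment {p q : ℝ × ℝ} (h : p ≠ q) : IsPlaneArc p q (segment ℝ p q) := by
  refine ⟨⟨⟨fun t : unitInterval => AffineMap.lineMap p q (t : ℝ), by fun_prop⟩,
    by simp, by simp⟩, ?_, ?_⟩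
  · intro s t hst
    exact Subtype.ext (AffineMap.lineMap_injective ℝ h hst)
  · rw [segment_eq_image_lineMap]
    ext z
    simp only [Set.mem_range, Set.mem_image]
    constructor
    · rintro ⟨t, rfl⟩
      exact ⟨t, t.2, rfl⟩
    · rintro ⟨t, ht, rfl⟩
      exact ⟨⟨t, ht⟩, rfl⟩

/-- The edge `uv`, in an integral drawing, goes one step to the right or one level up. -/
def IsLevelStep (x y : V → ℤ) (u v : V) : Prop :=
  (y v = y u ∧ x v = x u + 1) ∨ y v = y u + 1

/-- A graph with an injective placement in `ℤ × ℤ` is planar if all its edges join neighbouring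
points of a level or points of consecutive levels, without inversions between two levels. -/
theorem isPlanar_of_levels (x y : V → ℤ) (hinj : ∀ u v, x u = x v → y u = y v → u = v)
    (hstep : ∀ u v, G.Adj u v → IsLevelStep x y u v ∨ IsLevelStep x y v u)
    (hord : ∀ u v u' v', G.Adj u v → G.Adj u' v' → y v = y u + 1 → y u' = y u →
      y v' = y u + 1 → x u < x u' → x v ≤ x v') : G.IsPlanar := by
  let pt : V → ℝ × ℝ := fun v => (x v, y v)
  have hpt : Function.Injective pt := by
    intro u v h
    simp only [pt, Prod.mk.injEq, Int.cast_inj] at h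
    exact hinj u v h.1 h.2
  let arc : Sym2 V → Set (ℝ × ℝ) :=
    Sym2.lift ⟨fun u v => segment ℝ (pt u) (pt v), fun u v => segment_symm ℝ _ _⟩
  have harc : ∀ u v, arc s(u, v) = segment ℝ (pt u) (pt v) := fun u v => rfl
  have hmem : ∀ u v z, z ∈ arc s(u, v) → ∃ s : ℝ, 0 ≤ s ∧ s ≤ 1 ∧
      z.1 = x u + s * (x v - x u) ∧ z.2 = y u + s * (y v - y u) := by
    intro u v z hz
    rw [harc, segment_eq_image] at hz
    obtain ⟨s, ⟨h0, h1⟩, rfl⟩ := hz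
    refine ⟨s, h0, h1, ?_, ?_⟩ <;> simp [pt] <;> ring
  -- Along every edge some coordinate advances by exactly one, so integral values of it occur only
  -- at the ends.
  have hint : ∀ (s : ℝ) (p q : ℤ), 0 ≤ s → s ≤ 1 → (p : ℝ) = q + s → s = 0 ∨ s = 1 := by
    intro s p q h0 h1 h
    have a1 : q ≤ p := by exact_mod_cast (by linarith : (q : ℝ) ≤ p)
    have a2 : p ≤ q + 1 := by exact_mod_cast (by linarith : (p : ℝ) ≤ q + 1)
    rcases (by omega : p = q ∨ p = q + 1) with rfl | rfl
    · left; linarith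
    · right; push_cast at h; linarith
  have hend : ∀ u v w, IsLevelStep x y u v → pt w ∈ arc s(u, v) → w = u ∨ w = v := by
    intro u v w huv hw
    obtain ⟨s, h0, h1, hx, hy⟩ := hmem _ _ _ hw
    simp only [pt] at hx hy
    have hs : s = 0 ∨ s = 1 := by
      rcases huv with ⟨hyv, hxv⟩ | hyv
      · rw [hxv] at hx; push_cast at hx
        exact hint s (x w) (x u) h0 h1 (by linarith)
      · rw [hyv] at hy; push_cast at hy
        exact hint s (y w) (y u) h0 h1 (by linarith)
    rcases hs with rfl | rfl
    · left
      exact hinj _ _ (by exact_mod_cast (by linarith : (x w : ℝ) = x u))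
        (by exact_mod_cast (by linarith : (y w : ℝ) = y u))
    · right
      exact hinj _ _ (by exact_mod_cast (by linarith : (x w : ℝ) = x v))
        (by exact_mod_cast (by linarith : (y w : ℝ) = y v))
  have hend' : ∀ u v w, G.Adj u v → pt w ∈ arc s(u, v) → w = u ∨ w = v := by
    intro u v w huv hw
    rcases hstep u v huv with h | h
    · exact hend u v w h hw
    · rw [Sym2.eq_swap] at hw
      exact (hend v u w h hw).symm
  have hor : ∀ e ∈ G.edgeSet, ∃ u v, e = s(u, v) ∧ G.Adj u v ∧ IsLevelStep x y u v := by
    intro e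
    induction e using Sym2.ind with
    | _ u v =>
      intro h
      rcases hstep u v h with h' | h'
      · exact ⟨u, v, rfl, h, h'⟩
      · exact ⟨v, u, Sym2.eq_swap, h.symm, h'⟩
  refine ⟨pt, arc, hpt, fun u v huv => isPlaneArc_segment (hpt.ne huv.ne), hend', ?_⟩
  rintro e he f hf hne z ⟨hze, hzf⟩
  obtain ⟨u, v, rfl, huv, hsuv⟩ := hor e he
  obtain ⟨u', v', rfl, huv', hsuv'⟩ := hor f hf
  -- It now suffices to show that a common point of the two edges is the point of some vertex.
  have hvert : ∀ w, pt w = z → ∃ w : V, w ∈ s(u, v) ∧ w ∈ s(u', v') ∧ pt w = z := by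
    rintro w rfl
    exact ⟨w, by simpa using hend _ _ _ hsuv hze, by simpa using hend _ _ _ hsuv' hzf, rfl⟩
  obtain ⟨s, hs0, hs1, hsx, hsy⟩ := hmem _ _ _ hze
  obtain ⟨t, ht0, ht1, htx, hty⟩ := hmem _ _ _ hzf
  have hs : s = 0 ∨ s = 1 → ∃ w : V, w ∈ s(u, v) ∧ w ∈ s(u', v') ∧ pt w = z := by
    rintro (rfl | rfl)
    · exact hvert u (Prod.ext (by simp only [pt]; linarith) (by simp only [pt]; linarith))
    · exact hvert v (Prod.ext (by simp only [pt]; linarith) (by simp only [pt]; linarith))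
  have ht : t = 0 ∨ t = 1 → ∃ w : V, w ∈ s(u, v) ∧ w ∈ s(u', v') ∧ pt w = z := by
    rintro (rfl | rfl)
    · exact hvert u' (Prod.ext (by simp only [pt]; linarith) (by simp only [pt]; linarith))
    · exact hvert v' (Prod.ext (by simp only [pt]; linarith) (by simp only [pt]; linarith))
  have hsame : u = u' → v = v' → False := by
    rintro rfl rfl
    exact hne rfl
  rcases hsuv with ⟨hyv, hxv⟩ | hyv <;> rcases hsuv' with ⟨hyv', hxv'⟩ | hyv'
  · rw [hyv] at hsy; rw [hyv'] at hty; rw [hxv] at hsx; rw [hxv'] at htx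
    push_cast at hsx htx
    have hyy : y u = y u' := by exact_mod_cast (by linarith : (y u : ℝ) = y u')
    have a1 : x u' ≤ x u + 1 := by exact_mod_cast (by linarith : (x u' : ℝ) ≤ x u + 1)
    have a2 : x u ≤ x u' + 1 := by exact_mod_cast (by linarith : (x u : ℝ) ≤ x u' + 1)
    rcases (by omega : x u' = x u ∨ x u' = x u + 1 ∨ x u = x u' + 1) with h | h | h
    · exact (hsame (hinj _ _ h.symm hyy) (hinj _ _ (by omega) (by omega))).elim
    · rw [h] at htx; push_cast at htx
      exact ht (Or.inl (by linarith))
    · rw [h] at hsx; push_cast at hsx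
      exact hs (Or.inl (by linarith))
  · rw [hyv] at hsy; rw [hyv'] at hty; push_cast at hsy hty
    exact ht (hint t (y u) (y u') ht0 ht1 (by linarith))
  · rw [hyv] at hsy; rw [hyv'] at hty; push_cast at hsy hty
    exact hs (hint s (y u') (y u) hs0 hs1 (by linarith))
  · rw [hyv] at hsy; rw [hyv'] at hty; push_cast at hsy hty
    have a1 : y u' ≤ y u + 1 := by exact_mod_cast (by linarith : (y u' : ℝ) ≤ y u + 1)
    have a2 : y u ≤ y u' + 1 := by exact_mod_cast (by linarith : (y u : ℝ) ≤ y u' + 1)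
    rcases (by omega : y u' = y u ∨ y u' = y u + 1 ∨ y u = y u' + 1) with h | h | h
    · have hst : s = t := by rw [h] at hty; linarith
      subst hst
      by_cases hs' : s = 0 ∨ s = 1
      · exact hs hs'
      push Not at hs'
      have p0 : 0 < s := lt_of_le_of_ne hs0 hs'.1.symm
      have p1 : 0 < 1 - s := sub_pos.2 (lt_of_le_of_ne hs1 hs'.2)
      -- At a common interior point the gaps at the lower and upper ends have a weighted mean of
      -- zero. Without inversions the gaps cannot have opposite signs, so both vanish and the edges
      -- coincide.
      have hcomb : (1 - s) * ((x u' : ℝ) - x u) + s * ((x v' : ℝ) - x v) = 0 := by linarith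
      exfalso
      rcases lt_trichotomy (x u) (x u') with hlt | heq | hlt
      · have h1 := hord u v u' v' huv huv' hyv h (by omega) hlt
        have h1' : (x v : ℝ) ≤ x v' := by exact_mod_cast h1
        have hlt' : (x u : ℝ) < x u' := by exact_mod_cast hlt
        have := mul_pos p1 (sub_pos.2 hlt')
        have := mul_nonneg p0.le (sub_nonneg.2 h1')
        linarith
      · rw [heq, sub_self, mul_zero, zero_add] at hcomb
        have hv : (x v' : ℝ) - x v = 0 := (mul_eq_zero.1 hcomb).resolve_left p0.ne'
        have hv' : x v' = x v := by exact_mod_cast sub_eq_zero.1 hv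
        exact hsame (hinj _ _ heq h.symm) (hinj _ _ hv'.symm (by omega))
      · have h1 := hord u' v' u v huv' huv hyv' h.symm (by omega) hlt
        have h1' : (x v' : ℝ) ≤ x v := by exact_mod_cast h1
        have hlt' : (x u' : ℝ) < x u := by exact_mod_cast hlt
        have := mul_pos p1 (sub_pos.2 hlt')
        have := mul_nonneg p0.le (sub_nonneg.2 h1')
        linarith
    · rw [h] at hty; push_cast at hty
      exact ht (Or.inl (by linarith))
    · rw [h] at hsy; push_cast at hsy
      exact hs (Or.inl (by linarith))

/-! ### Reachability avoiding a set, and lower bounds for distances -/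

/-- `u` and `v` are joined by a walk that avoids `X`. -/
def ReachableAvoiding (G : SimpleGraph V) (X : Finset V) (u v : V) : Prop :=
  ∃ (hu : u ∉ X) (hv : v ∉ X), (G.induce {v : V | v ∉ X}).Reachable ⟨u, hu⟩ ⟨v, hv⟩

namespace ReachableAvoiding

variable {X : Finset V} {u v w : V}

theorem refl (hu : u ∉ X) : G.ReachableAvoiding X u u := ⟨hu, hu, Reachable.refl _⟩

theorem symm : G.ReachableAvoiding X u v → G.ReachableAvoiding X v u :=
  fun ⟨hu, hv, h⟩ => ⟨hv, hu, h.symm⟩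

theorem trans : G.ReachableAvoiding X u v → G.ReachableAvoiding X v w →
    G.ReachableAvoiding X u w :=
  fun ⟨hu, _, h⟩ ⟨_, hw, h'⟩ => ⟨hu, hw, h.trans h'⟩

theorem of_adj (h : G.Adj u v) (hu : u ∉ X) (hv : v ∉ X) : G.ReachableAvoiding X u v :=
  ⟨hu, hv, Adj.reachable h⟩

end ReachableAvoiding

theorem le_edist_of_lipschitz (f : V → ℕ) (hf : ∀ u v, G.Adj u v → f v ≤ f u + 1) (u v : V) :
    (f v : ℕ∞) ≤ f u + G.edist u v := by
  by_cases h : G.edist u v = ⊤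
  · simp [h]
  obtain ⟨w, hw⟩ := exists_walk_of_edist_ne_top h
  rw [← hw]
  have key : ∀ (a b : V) (w : G.Walk a b), f b ≤ f a + w.length := by
    intro a b w
    induction w with
    | nil => simp
    | cons hab _ ih =>
      have := hf _ _ hab
      rw [Walk.length_cons]
      omega
  exact_mod_cast key _ _ w

end SimpleGraph

/-! ### The extremal graph -/

namespace TowerGraph

/-- `(t, some (j, c))` is the vertex of tower `t` in layer `j` (counted from the base) and column
`c`; `(t, none)` is the tip of tower `t`. -/
abbrev Vertex (m a : ℕ) : Type := Fin a × Option (Fin m × Fin 3)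

variable {m a : ℕ}

/-- The edges: each tower is a grid with three columns whose last layer is joined to the tip;
the bases of the towers `1, 2, …` form a path, all of which is joined to the middle of
the base of tower `0`, and whose ends are joined to the ends of that base. -/
inductive Link : Vertex m a → Vertex m a → Prop
  | side (t : Fin a) (j : Fin m) (c c' : Fin 3) (h : c'.val = c.val + 1) :
      Link (t, some (j, c)) (t, some (j, c'))
  | ray (t : Fin a) (j j' : Fin m) (c : Fin 3) (h : j'.val = j.val + 1) :
      Link (t, some (j, c)) (t, some (j', c))
  | tip (t : Fin a) (j : Fin m) (c : Fin 3) (h : j.val + 1 = m) :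
      Link (t, some (j, c)) (t, none)
  | row (t t' : Fin a) (j : Fin m) (hj : j.val = 0) (ht : t.val ≠ 0) (h : t'.val = t.val + 1) :
      Link (t, some (j, 2)) (t', some (j, 0))
  | hub (t t' : Fin a) (j : Fin m) (c : Fin 3) (hj : j.val = 0) (ht : t.val = 0)
      (ht' : t'.val ≠ 0) : Link (t, some (j, 1)) (t', some (j, c))
  | first (t t' : Fin a) (j : Fin m) (hj : j.val = 0) (ht : t.val = 0) (ht' : t'.val = 1) :
      Link (t, some (j, 0)) (t', some (j, 0))
  | last (t t' : Fin a) (j : Fin m) (hj : j.val = 0) (ht : t.val = 0) (ht0 : t'.val ≠ 0)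
      (ht' : t'.val + 1 = a) : Link (t, some (j, 2)) (t', some (j, 2))

/-- The extremal graph, with `a` towers of height `m`. -/
def graph (m a : ℕ) : SimpleGraph (Vertex m a) := SimpleGraph.fromRel Link

theorem Link.ne {u v : Vertex m a} (h : Link u v) : u ≠ v := by
  cases h <;> simp [Fin.ext_iff] <;> omega

theorem adj_iff {u v : Vertex m a} : (graph m a).Adj u v ↔ Link u v ∨ Link v u := by
  rw [graph, SimpleGraph.fromRel_adj]
  exact ⟨fun h => h.2, fun h => ⟨h.elim Link.ne fun h => h.ne.symm, h⟩⟩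

theorem Link.adj {u v : Vertex m a} (h : Link u v) : (graph m a).Adj u v := adj_iff.2 (Or.inl h)

/-! ### Planarity of the extremal graph -/

/-- The layer of a vertex; the tip has layer `m`. -/
def depth (v : Vertex m a) : ℕ := v.2.elim m fun p => p.1.val

/-- The column of a vertex; the tip is put above the middle column. -/
def col (v : Vertex m a) : ℕ := v.2.elim 1 fun p => p.2.val

/-- Horizontal coordinate in the drawing. -/
def xcoord (v : Vertex m a) : ℤ := 3 * v.1.val + col v

/-- Vertical coordinate in the drawing; tower `0` points downwards. -/
def ycoord (v : Vertex m a) : ℤ := if v.1.val = 0 then -1 - (depth v : ℤ) else depth v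

@[simp] theorem depth_some (t : Fin a) (j : Fin m) (c : Fin 3) :
    depth ((t, some (j, c)) : Vertex m a) = j.val := rfl

@[simp] theorem depth_none (t : Fin a) : depth ((t, none) : Vertex m a) = m := rfl

@[simp] theorem col_some (t : Fin a) (j : Fin m) (c : Fin 3) :
    col ((t, some (j, c)) : Vertex m a) = c.val := rfl

@[simp] theorem col_none (t : Fin a) : col ((t, none) : Vertex m a) = 1 := rfl

theorem coord_injective (u v : Vertex m a) (hx : xcoord u = xcoord v) (hy : ycoord u = ycoord v) :
    u = v := by
  obtain ⟨t, _ | ⟨j, c⟩⟩ := u <;> obtain ⟨t', _ | ⟨j', c'⟩⟩ := v <;>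
    simp only [xcoord, ycoord, depth_some, depth_none, col_some, col_none] at hx hy <;>
    simp only [Prod.mk.injEq, Option.some.injEq, Fin.ext_iff, reduceCtorEq, and_true, and_false] <;>
    split_ifs at hy <;> omega

theorem Link.isLevelStep {u v : Vertex m a} (h : Link u v) :
    SimpleGraph.IsLevelStep xcoord ycoord u v ∨ SimpleGraph.IsLevelStep xcoord ycoord v u := by
  unfold SimpleGraph.IsLevelStep
  cases h <;>
    simp only [xcoord, ycoord, depth_some, depth_none, col_some, col_none, Fin.val_zero,
      Fin.val_one, Fin.val_two, true_and] <;> split_ifs <;> omega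

/-- The position of the edges between two consecutive levels. -/
theorem up_cases {u v : Vertex m a} (h : (graph m a).Adj u v) (hy : ycoord v = ycoord u + 1) :
    ∃ t : ℤ, (0 ≤ ycoord u ∧ 3 * t ≤ xcoord u ∧ xcoord u ≤ 3 * t + 2 ∧
      ((xcoord v = xcoord u ∧ ycoord v < m) ∨ (ycoord v = m ∧ xcoord v = 3 * t + 1))) ∨
    (ycoord v < 0 ∧ 0 ≤ xcoord v ∧ xcoord v ≤ 2 ∧
      ((xcoord v = xcoord u ∧ -1 - (m : ℤ) < ycoord u) ∨
        (ycoord u = -1 - m ∧ xcoord u = 1))) ∨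
    (ycoord u = -1 ∧ 3 ≤ xcoord v ∧ xcoord v < 3 * a ∧
      ((xcoord u = 0 ∧ xcoord v = 3) ∨ xcoord u = 1 ∨
        (xcoord u = 2 ∧ xcoord v = 3 * a - 1))) := by
  refine ⟨u.1.val, ?_⟩
  rcases adj_iff.1 h with h | h <;> cases h <;>
    simp only [xcoord, ycoord, depth_some, depth_none, col_some, col_none, Fin.val_zero,
      Fin.val_one, Fin.val_two, true_and] at hy ⊢ <;> split_ifs at hy ⊢ <;> omega

/-- Inside a tower the rays are vertical until they converge at the tip. Between levels `-1` and `0`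
the left, middle and right base vertices of tower `0` are joined to the leftmost, to all and to the
rightmost vertices of the path of bases, so no inversion occurs. -/
theorem isPlanar : (graph m a).IsPlanar := by
  refine SimpleGraph.isPlanar_of_levels xcoord ycoord coord_injective ?_ ?_
  · intro u v h
    rcases adj_iff.1 h with h | h
    · exact h.isLevelStep
    · exact h.isLevelStep.symm
  · intro u v u' v' h h' hy hyu hyv hlt
    rcases up_cases h hy with ⟨t, h1⟩
    rcases up_cases h' (by omega) with ⟨t', h2⟩
    omega

/-! ### Distances between tips -/

theorem Link.near {u v : Vertex m a} (h : Link u v) :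
    (u.1 = v.1 ∧ depth u ≤ depth v + 1 ∧ depth v ≤ depth u + 1) ∨
      (depth u = 0 ∧ depth v = 0) := by
  cases h <;> simp only [depth_some, depth_none, true_and] <;> omega

theorem lt_edist_tips {t t' : Fin a} (h : t ≠ t') :
    ((m + m : ℕ) : ℕ∞) < (graph m a).edist (t, none) (t', none) := by
  -- This potential is `0` at the tip of `t`, `m` on its base, `m + 1` on the other bases and `2m +
  -- 1` at the other tips.
  let f : Vertex m a → ℕ := fun v => if v.1 = t then m - depth v else m + 1 + depth v
  have hdepth : ∀ v : Vertex m a, depth v ≤ m := by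
    rintro ⟨t, _ | ⟨j, c⟩⟩
    · exact le_rfl
    · exact j.2.le
  have hf : ∀ u v, (graph m a).Adj u v → f v ≤ f u + 1 := by
    intro u v huv
    have hu := hdepth u
    have hv := hdepth v
    have hn : (u.1 = v.1 ∧ depth u ≤ depth v + 1 ∧ depth v ≤ depth u + 1) ∨
        (depth u = 0 ∧ depth v = 0) := by
      rcases adj_iff.1 huv with h | h
      · exact h.near
      · rcases h.near with ⟨h1, h2, h3⟩ | ⟨h1, h2⟩
        · exact Or.inl ⟨h1.symm, h3, h2⟩
        · exact Or.inr ⟨h2, h1⟩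
    simp only [f]
    rcases hn with ⟨h1, h2, h3⟩ | ⟨h1, h2⟩
    · rw [h1]
      split_ifs <;> omega
    · split_ifs <;> omega
  have := SimpleGraph.le_edist_of_lipschitz f hf (t, none) (t', none)
  simp only [f, depth_none, if_true, if_neg h.symm, Nat.sub_self, Nat.cast_zero, zero_add] at this
  refine lt_of_lt_of_le ?_ this
  exact_mod_cast (by omega : m + m < m + 1 + m)

/-! ### Connectivity of the extremal graph -/

section Connectivity

variable {X : Finset (Vertex m a)}

open SimpleGraph

theorem reach_base (t : Fin a) (c : Fin 3) (j₀ : Fin m) (h0 : j₀.val = 0) (j : Fin m)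
    (h : ∀ i ≤ j, (t, some (i, c)) ∉ X) :
    (graph m a).ReachableAvoiding X (t, some (j, c)) (t, some (j₀, c)) := by
  obtain ⟨n, hn⟩ := j
  induction n with
  | zero =>
    have : j₀ = ⟨0, hn⟩ := Fin.ext h0
    subst this
    exact .refl (h _ le_rfl)
  | succ n ih =>
    have hle : (⟨n, by omega⟩ : Fin m) ≤ ⟨n + 1, hn⟩ := Fin.mk_le_mk.2 n.le_succ
    exact (ReachableAvoiding.of_adj (Link.ray t ⟨n, by omega⟩ ⟨n + 1, hn⟩ c rfl).adj
      (h _ hle) (h _ le_rfl)).symm.trans (ih _ fun i hi => h i (hi.trans hle))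

theorem reach_tip (t : Fin a) (c : Fin 3) (j : Fin m) (htip : (t, none) ∉ X)
    (h : ∀ i, j ≤ i → (t, some (i, c)) ∉ X) :
    (graph m a).ReachableAvoiding X (t, some (j, c)) (t, none) := by
  obtain ⟨d, hd⟩ : ∃ d, j.val + d + 1 = m := ⟨m - 1 - j.val, by omega⟩
  induction d generalizing j with
  | zero => exact .of_adj (Link.tip t j c hd).adj (h _ le_rfl) htip
  | succ d ih =>
    have hle : j ≤ ⟨j.val + 1, by omega⟩ := Fin.mk_le_mk.2 (Nat.le_succ _)
    exact (ReachableAvoiding.of_adj (Link.ray t j ⟨j.val + 1, by omega⟩ c rfl).adj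
      (h _ le_rfl) (h _ hle)).trans (ih _ (fun i hi => h i (hle.trans hi)) (by simp; omega))

theorem side_adj (t : Fin a) (j : Fin m) (c c' : Fin 3)
    (h : c.val + 1 = c'.val ∨ c'.val + 1 = c.val) :
    (graph m a).Adj (t, some (j, c)) (t, some (j, c')) := by
  rcases h with h | h
  · exact (Link.side t j c c' h.symm).adj
  · exact (Link.side t j c' c h.symm).adj.symm

theorem false_of_three_mem (hX : X.card < 3) {u v w : Vertex m a} (hu : u ∈ X) (hv : v ∈ X)
    (hw : w ∈ X) (huv : u ≠ v) (huw : u ≠ w) (hvw : v ≠ w) : False := by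
  have : 2 < X.card := Finset.two_lt_card.2 ⟨u, hu, v, hv, w, hw, huv, huw, hvw⟩
  omega

/-- In every tower, what is left after two deletions reaches the base. -/
theorem exists_reach_base (hX : X.card < 3) (j₀ : Fin m) (h0 : j₀.val = 0) (v : Vertex m a)
    (hv : v ∉ X) : ∃ c, (graph m a).ReachableAvoiding X v (v.1, some (j₀, c)) := by
  have hle : ∀ j, j₀ ≤ j := fun j => Fin.le_def.2 (by omega)
  obtain ⟨t, _ | ⟨j, c⟩⟩ := v
  · have : ∃ c : Fin 3, ∀ i, (t, some (i, c)) ∉ X := by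
      by_contra! hc
      obtain ⟨i0, h0⟩ := hc 0
      obtain ⟨i1, h1⟩ := hc 1
      obtain ⟨i2, h2⟩ := hc 2
      exact false_of_three_mem hX h0 h1 h2 (by simp) (by simp) (by simp)
    obtain ⟨c, hc⟩ := this
    exact ⟨c, (reach_tip t c j₀ hv fun i _ => hc i).symm⟩
  · obtain ⟨c', c'', hside, h1, h2, h3⟩ : ∃ c' c'' : Fin 3,
        (c.val + 1 = c'.val ∨ c'.val + 1 = c.val) ∧ c ≠ c' ∧ c ≠ c'' ∧ c' ≠ c'' := by
      clear hv; revert c; decide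
    by_cases hc' : ∀ i, (t, some (i, c')) ∉ X
    · exact ⟨c', (ReachableAvoiding.of_adj (side_adj t j c c' hside) hv (hc' j)).trans
        (reach_base t c' j₀ h0 j fun i _ => hc' i)⟩
    by_cases hc : ∀ i ≤ j, (t, some (i, c)) ∉ X
    · exact ⟨c, reach_base t c j₀ h0 j hc⟩
    -- Both deletions are now located: one in column `c'`, one below the vertex in column `c`. The
    -- way up to the tip and down the third column is free.
    push Not at hc' hc
    obtain ⟨i', hi'⟩ := hc'
    obtain ⟨i, hij, hi⟩ := hc
    have htip : (t, none) ∉ X := fun h =>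
      false_of_three_mem hX hi' hi h (by simp [h1.symm]) (by simp) (by simp)
    refine ⟨c'', (reach_tip t c j htip fun l hl h => ?_).trans
      (reach_tip t c'' j₀ htip fun l _ h => ?_).symm⟩
    · have hne : i ≠ j := by
        rintro rfl
        exact hv hi
      have hil : i ≠ l := (lt_of_lt_of_le (lt_of_le_of_ne hij hne) hl).ne
      exact false_of_three_mem hX hi' hi h (by simp [h1.symm]) (by simp [h1.symm]) (by simp [hil])
    · exact false_of_three_mem hX hi' hi h (by simp [h1.symm]) (by simp [h3]) (by simp [h2])

/-- Along the path of bases, a stretch without deleted vertices is connected. The vertex in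
position `3 * t + c` is the one in column `c` of tower `t`. -/
theorem reach_row (j₀ : Fin m) (h0 : j₀.val = 0) (n d : ℕ) (t t' : Fin a) (c c' : Fin 3)
    (ht : t.val ≠ 0) (hn : 3 * t.val + c.val = n) (hd : 3 * t'.val + c'.val = n + d)
    (h : ∀ (s : Fin a) (e : Fin 3), n ≤ 3 * s.val + e.val → 3 * s.val + e.val ≤ n + d →
      (s, some (j₀, e)) ∉ X) :
    (graph m a).ReachableAvoiding X (t, some (j₀, c)) (t', some (j₀, c')) := by
  induction d generalizing t' c' with
  | zero =>
    obtain rfl : t = t' := Fin.ext (by omega)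
    obtain rfl : c = c' := Fin.ext (by omega)
    exact .refl (h _ _ hn.ge (by omega))
  | succ d ih =>
    have hX' := h t' c' (by omega) (by omega)
    have ih' := fun s e hs => ih s e hs fun s e h1 h2 => h s e h1 (by omega)
    by_cases hc : c'.val = 0
    · obtain rfl : c' = 0 := Fin.ext hc
      let s : Fin a := ⟨t'.val - 1, by omega⟩
      have hs : s.val = t'.val - 1 := rfl
      have hs2 : 3 * s.val + (2 : Fin 3).val = n + d := by
        simp only [Fin.val_two, Fin.val_zero] at hd ⊢
        omega
      refine (ih' s 2 hs2).trans (.of_adj (Link.row s t' j₀ h0 ?_ ?_).adj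
        (h _ _ (by omega) (by omega)) hX') <;> simp only [Fin.val_two, Fin.val_zero] at hd hs2 <;>
        omega
    · let e : Fin 3 := ⟨c'.val - 1, by omega⟩
      have he : e.val = c'.val - 1 := rfl
      exact (ih' t' e (by omega)).trans (.of_adj (side_adj t' j₀ e c' (by omega))
        (h _ _ (by omega) (by omega)) hX')

/-- The vertices of the bases are connected to each other after two deletions. -/
theorem reach_bases (hX : X.card < 3) (ha : 2 ≤ a) (j₀ : Fin m) (h0 : j₀.val = 0)
    (t t' : Fin a) (c c' : Fin 3) (hv : (t, some (j₀, c)) ∉ X) (hv' : (t', some (j₀, c')) ∉ X) :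
    (graph m a).ReachableAvoiding X (t, some (j₀, c)) (t', some (j₀, c')) := by
  let z : Fin a := ⟨0, by omega⟩
  let o : Fin a := ⟨1, by omega⟩
  let l : Fin a := ⟨a - 1, by omega⟩
  have hz : ∀ s : Fin a, s.val = 0 → s = z := fun s hs => Fin.ext hs
  have hzo : z ≠ o := by simp [z, o]
  have hlv : l.val = a - 1 := rfl
  by_cases hq : (z, some (j₀, 1)) ∈ X
  · -- The hub is deleted: use the cycle formed by the path of bases and tower `0`.
    let A : Vertex m a := (z, some (j₀, 0))
    let B : Vertex m a := (z, some (j₀, 2))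
    have hone : ∀ u w : Vertex m a, u ∈ X → w ∈ X → u ≠ (z, some (j₀, 1)) →
        w ≠ (z, some (j₀, 1)) → u = w := by
      intro u w hu hw hu' hw'
      by_contra hne
      exact false_of_three_mem hX hq hu hw hu'.symm hw'.symm hne
    -- If the other deletion lies outside tower `0`, the outer columns of that tower are intact and
    -- joined through its tip.
    have hcol : ∀ s : Vertex m a, s ∈ X → s.1 ≠ z →
        (graph m a).ReachableAvoiding X A B := by
      intro s hs hsz
      have hout : ∀ w : Vertex m a, w.1 = z → w ≠ (z, some (j₀, 1)) → w ∉ X := by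
        intro w hw hw' hwX
        have := hone s w hs hwX (fun h => hsz (by rw [h])) hw'
        exact hsz (this ▸ hw)
      have htip : ((z, none) : Vertex m a) ∉ X := hout _ rfl (by simp)
      exact (reach_tip z 0 j₀ htip fun i _ => hout _ rfl (by simp)).trans
        (reach_tip z 2 j₀ htip fun i _ => hout _ rfl (by simp)).symm
    -- If all deletions lie in tower `0`, the whole path of bases survives; it starts at position
    -- `3`.
    have hrow : (∀ s : Vertex m a, s ∈ X → s.1 = z) → ∀ (t t' : Fin a) (c c' : Fin 3),
        t ≠ z → t' ≠ z → (graph m a).ReachableAvoiding X (t, some (j₀, c)) (t', some (j₀, c')) := by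
      intro hs
      have hfrom : ∀ (t : Fin a) (c : Fin 3), t ≠ z →
          (graph m a).ReachableAvoiding X (o, some (j₀, 0)) (t, some (j₀, c)) := by
        intro t c ht
        have ht0 : t.val ≠ 0 := fun h => ht (hz t h)
        refine reach_row j₀ h0 3 (3 * t.val + c.val - 3) o t 0 c (by simp [o]) (by simp [o])
          (by omega) fun s e hse _ hsX => ?_
        have := congrArg Fin.val (hs _ hsX)
        simp only [z] at this
        omega
      exact fun t t' c c' ht ht' => (hfrom t c ht).symm.trans (hfrom t' c' ht')
    have hval : ∀ s : Fin a, s ≠ z → s.val ≠ 0 := fun s hs h => hs (hz s h)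
    have hlz : l ≠ z := fun h => by
      have := congrArg Fin.val h
      simp only [l, z] at this
      omega
    have hfirst : (z, some (j₀, 0)) ∉ X → (o, some (j₀, 0)) ∉ X →
        (graph m a).ReachableAvoiding X (z, some (j₀, 0)) (o, some (j₀, 0)) :=
      .of_adj (Link.first z o j₀ h0 rfl rfl).adj
    have hlast : (z, some (j₀, 2)) ∉ X → (l, some (j₀, 2)) ∉ X →
        (graph m a).ReachableAvoiding X (z, some (j₀, 2)) (l, some (j₀, 2)) :=
      .of_adj (Link.last z l j₀ h0 rfl (hval l hlz) (by omega)).adj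
    have hbase : ∀ e : Fin 3, (z, some (j₀, e)) ∉ X → e = 0 ∨ e = 2 := by
      intro e he
      have h1 : e ≠ 1 := by
        rintro rfl
        exact he hq
      clear he
      revert e
      decide
    by_cases hs : ∀ s : Vertex m a, s ∈ X → s.1 = z
    · have hall : ∀ (t : Fin a) (c : Fin 3), (t, some (j₀, c)) ∉ X →
          (graph m a).ReachableAvoiding X (t, some (j₀, c)) (o, some (j₀, 0)) := by
        intro t c hv
        by_cases ht : t = z
        · subst ht
          rcases hbase c hv with rfl | rfl
          · exact hfirst hv fun h => hzo (hs _ h).symm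
          · exact (hlast hv fun h => hlz (hs _ h)).trans (hrow hs l o 2 0 hlz hzo.symm)
        · exact hrow hs t o c 0 ht hzo.symm
      exact (hall t c hv).trans (hall t' c' hv').symm
    · push Not at hs
      obtain ⟨s, hsX, hsz⟩ := hs
      have hAB := hcol s hsX hsz
      obtain ⟨hA, hB, _⟩ := id hAB
      have hall : ∀ (t : Fin a) (c : Fin 3), (t, some (j₀, c)) ∉ X →
          (graph m a).ReachableAvoiding X (t, some (j₀, c)) A := by
        intro t c hv
        by_cases ht : t = z
        · subst ht
          rcases hbase c hv with rfl | rfl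
          · exact .refl hv
          · exact hAB.symm
        have ht0 := hval t ht
        -- The single remaining deletion blocks the path on at most one side. If the left is
        -- blocked, the route goes right to `l`, then to `B`, and through the tip of tower `0` to
        -- `A`.
        by_cases hleft : ∀ (s : Fin a) (e : Fin 3), 3 ≤ 3 * s.val + e.val →
            3 * s.val + e.val ≤ 3 + (3 * t.val + c.val - 3) → (s, some (j₀, e)) ∉ X
        · have hr := reach_row j₀ h0 3 (3 * t.val + c.val - 3) o t 0 c (by simp [o]) (by simp [o])
            (by omega) hleft
          exact hr.symm.trans (hfirst hA hr.1).symm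
        · push Not at hleft
          obtain ⟨s₁, e₁, h1, h2, h3⟩ := hleft
          have hs1 : s₁ ≠ z := by
            rintro rfl
            simp only [z] at h1
            omega
          have hr := reach_row (X := X) j₀ h0 (3 * t.val + c.val) 
            (3 * l.val + 2 - (3 * t.val + c.val))
            t l c 2 ht0 rfl (by simp only [Fin.val_two]; omega) fun s₂ e₂ h4 _ h6 => by
              have hs2 : s₂ ≠ z := by
                rintro rfl
                simp only [z] at h4
                omega
              have heq := hone _ _ h3 h6 (fun h => hs1 (congrArg Prod.fst h))
                (fun h => hs2 (congrArg Prod.fst h))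
              simp only [Prod.mk.injEq, Option.some.injEq, true_and] at heq
              obtain ⟨rfl, rfl⟩ := heq
              obtain rfl : s₁ = t := Fin.ext (by omega)
              obtain rfl : e₁ = c := Fin.ext (by omega)
              exact hv h3
          exact hr.trans ((hlast hB hr.2.1).symm.trans hAB.symm)
      exact (hall t c hv).trans (hall t' c' hv').symm
  · -- The hub is present.
    have hhub : ∀ (s : Fin a) (e : Fin 3), (s, some (j₀, e)) ∉ X →
        (graph m a).ReachableAvoiding X (s, some (j₀, e)) (z, some (j₀, 1)) := by
      intro s e hs
      by_cases hsz : s.val = 0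
      · obtain rfl := hz s hsz
        by_cases he : e = 1
        · subst he
          exact .refl hq
        · refine .of_adj (side_adj z j₀ e 1 ?_) hs hq
          revert he
          clear hs
          revert e
          decide
      · exact (ReachableAvoiding.of_adj (Link.hub z s j₀ e h0 rfl hsz).adj hq hs).symm
    exact (hhub t c hv).trans (hhub t' c' hv').symm

theorem isVertexConnected (hm : 0 < m) (ha : 2 ≤ a) : (graph m a).IsVertexConnected 3 := by
  have hcard : Fintype.card (Vertex m a) = a * (m * 3 + 1) := by simp
  -- At least eight vertices: more than three, and some survive the deletion of `X`.
  have h8 : 2 * (1 * 3 + 1) ≤ a * (m * 3 + 1) := Nat.mul_le_mul ha (by omega)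
  refine ⟨by omega, fun X hX => ?_⟩
  have hex : ∃ v, v ∉ X := by
    by_contra! h
    have := Finset.card_le_card (fun v _ => h v : Finset.univ ⊆ X)
    rw [Finset.card_univ] at this
    omega
  obtain ⟨v₀, hv₀⟩ := hex
  have : Nonempty {v : Vertex m a | v ∉ X} := ⟨⟨v₀, hv₀⟩⟩
  refine ⟨fun u v => ?_⟩
  obtain ⟨c, hu⟩ := exists_reach_base hX ⟨0, hm⟩ rfl u u.2
  obtain ⟨c', hv⟩ := exists_reach_base hX ⟨0, hm⟩ rfl v v.2
  obtain ⟨_, hu', _⟩ := id hu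
  obtain ⟨_, hv', _⟩ := id hv
  obtain ⟨_, _, h⟩ := (hu.trans (reach_bases hX ha ⟨0, hm⟩ rfl _ _ c c' hu' hv')).trans hv.symm
  exact h

end Connectivity

end TowerGraph

theorem theorem3 (k a : ℕ) (hk : 0 < k) (hke : Even k) (ha : 2 ≤ a) :
    ∃ p : ℕ, IsLeast (polyhedralOrders k a) p ∧
      (p : ℚ) = a + 3 * a * ((k : ℚ) / 2) ∧
      (p : ℚ) = (3 / 2 * (k : ℚ) + 1) * a := by
  obtain ⟨m, rfl⟩ := hke
  refine ⟨a * (3 * m + 1), ⟨?_, ?_⟩, by push_cast; ring, by push_cast; ring⟩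
  · refine ⟨TowerGraph.Vertex m a, inferInstance, TowerGraph.graph m a, by simp [mul_comm 3 m],
      ⟨TowerGraph.isVertexConnected (by omega) ha, TowerGraph.isPlanar⟩,
      -- The independent set consists of the tips.
      Finset.univ.map ⟨fun t => (t, none), fun t t' h => congrArg Prod.fst h⟩, by simp, ?_⟩
    intro u hu v hv huv
    simp only [Finset.mem_map, Finset.mem_univ, true_and] at hu hv
    obtain ⟨t, rfl⟩ := hu
    obtain ⟨t', rfl⟩ := hv
    exact TowerGraph.lt_edist_tips fun h => huv (by rw [h])
  · rintro n ⟨V, _, G, rfl, hG, S, rfl, hS⟩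
    exact hG.1.card_mul_le_card hS ha
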